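/- Let $b,\beta_p,\beta_n,c_p,c_n>0$ and let $\alpha_p,\alpha_n<1$ be real numbers with $\alpha_p\neq 0$ and $\alpha_n\neq 0$. Let $L$ be a BCTS (bilateral classic tempered stable) process of finite variation with these parameters, i.e. a real càdlàg Lévy process with $L(0)=0$ a.s., with no Gaussian part and no drift, and with Lévy density $$\nu(x)=c_p\,\frac{e^{-\beta_p x}}{x^{1+\alpha_p}}\mathbf 1_{x\ge 0}+c_n\,\frac{e^{\beta_n x}}{|x|^{1+\alpha_n}}\mathbf 1_{x<0},$$ that is, $\mathbb E[e^{iuL(t)}]=\exp\left(t\int_{\mathbb R}(e^{iux}-1)\,\nu(x)\,dx\right)$ for all $u\in\mathbb R$ and $t\ge 0$. Let $$Z(t)=\int_0^t e^{-b(t-v)}\,dL(v)$$ be the (pathwise Lebesgue--Stieltjes) integral that occurs in the OU-BCTS process $X(t)=X(0)e^{-bt}+Z(t)$, the solution of $dX(t)=-bX(t)\,dt+dL(t)$. For $\alpha<1$, $s<\beta_1$ and $0<\beta_1\le\beta_2$ put $$\tilde I(s,\alpha,\beta_1,\beta_2)=\int_{\beta_1}^{\beta_2}z^{-1-\alpha}(z-s)^{\alpha}\,dz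 .$$ Then for every $t\ge 0$ and every $s$ with $-\beta_n<s<\beta_p$ the cumulant generating function $m_Z(s,t)=\ln\mathbb E[e^{sZ(t)}]$ exists, i.e. $\mathbb E[e^{sZ(t)}]<\infty$, and, with $a=e^{-bt}$, $$m_Z(s,t)=-\frac{c_p\,\beta_p^{\alpha_p}\,\Gamma(1-\alpha_p)}{\alpha_p\,b}\left[\tilde I\left(s,\alpha_p,\beta_p,\frac{\beta_p}{a}\right)+\log a\right]-\frac{c_n\,\beta_n^{\alpha_n}\,\Gamma(1-\alpha_n)}{\alpha_n\,b}\left[\tilde I\left(-s,\alpha_n,\beta_n,\frac{\beta_n}{a}\right)+\log a\right].$$ -/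

import Mathlib

open MeasureTheory ProbabilityTheory Filter Topology Set
open scoped NNReal

noncomputable section

/-- The bilateral classic tempered stable Lévy density
`cp * exp (-βp x) / x ^ (1 + αp)` for `x ≥ 0` and `cn * exp (βn x) / |x| ^ (1 + αn)` for `x < 0`. -/
def bctsDensity (αp αn βp βn cp cn : ℝ) (x : ℝ) : ℝ :=
  if 0 ≤ x then cp * (Real.exp (-(βp * x)) / x ^ (1 + αp))
  else cn * (Real.exp (βn * x) / |x| ^ (1 + αn))

/-- The Lévy measure with the density `bctsDensity`. -/
def bctsLevyMeasure (αp αn βp βn cp cn : ℝ) : Measure ℝ :=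
  volume.withDensity fun x => ENNReal.ofReal (bctsDensity αp αn βp βn cp cn x)

/-- `μ` is the law `BCTS(αp, αn, βp, βn, cp, cn)`, in the finite variation regime `αp, αn < 1`:
the infinitely divisible law without Gaussian part and without drift whose Lévy measure is
`bctsLevyMeasure`, given by its Lévy-Khintchine formula (no truncation function is needed since
`∫ min 1 |x|` is finite for this Lévy measure). -/
def IsBCTSLaw (μ : Measure ℝ) (αp αn βp βn cp cn : ℝ) : Prop :=
  ∀ u : ℝ, charFun μ u =
    Complex.exp (∫ x : ℝ, (Complex.exp (Complex.I * u * x) - 1)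
      ∂(bctsLevyMeasure αp αn βp βn cp cn))

/-- Real-valued Lévy processes. -/
structure IsLevyProcess {Ω : Type*} [MeasurableSpace Ω] (L : ℝ≥0 → Ω → ℝ) (P : Measure Ω) :
    Prop where
  aemeasurable : ∀ t, AEMeasurable (L t) P
  zero : ∀ᵐ ω ∂P, L 0 ω = 0
  indep_increments : HasIndepIncrements L P
  stationary_increments : ∀ s h, IdentDistrib (fun ω => L (s + h) ω - L s ω) (L h) P P
  cadlag : ∀ᵐ ω ∂P, ∀ t, ContinuousWithinAt (fun s => L s ω) (Ici t) t ∧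
    ∃ l, Tendsto (fun s => L s ω) (𝓝[<] t) (𝓝 l)

/-- `L` is a BCTS process: a Lévy process such that `L t` has the law
`BCTS(αp, αn, βp, βn, cp t, cn t)` for every `t`. -/
structure IsBCTSProcess {Ω : Type*} [MeasurableSpace Ω] (L : ℝ≥0 → Ω → ℝ) (P : Measure Ω)
    (αp αn βp βn cp cn : ℝ) : Prop extends IsLevyProcess L P where
  law : ∀ t : ℝ≥0, IsBCTSLaw (P.map (L t)) αp αn βp βn (cp * t) (cn * t)

open Classical in
/-- The Lebesgue-Stieltjes integral of `f` over `(0, t]` with respect to `g`, when `g` has bounded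
variation on `[0, t]` (that is, when `g` stopped at `t` has bounded variation); `0` otherwise. -/
def stieltjesIntegral (f g : ℝ≥0 → ℝ) (t : ℝ≥0) : ℝ :=
  if hg : BoundedVariationOn (fun s => g (min s t)) univ then
    ∫ᵛ s in Ioc 0 t, f s ∂•hg.vectorMeasure
  else 0

/-- The process `Z t = ∫ₛ exp (-b (t - s)) dL s`, `s` from `0` to `t`, taken path by path; the
Ornstein-Uhlenbeck process of mean-reversion rate `b` driven by `L` is `X t = X 0 exp (-b t) + Z t`.
Almost every path of a BCTS process with `αp, αn < 1` has bounded variation on `[0, t]`. -/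
def ouIntegral {Ω : Type*} (b : ℝ) (L : ℝ≥0 → Ω → ℝ) (t : ℝ≥0) (ω : Ω) : ℝ :=
  stieltjesIntegral (fun s => Real.exp (-(b * ((t : ℝ) - s)))) (fun s => L s ω) t

/-- The function `Ĩ(s, α, β₁, β₂)`. -/
def tildeI (s α β₁ β₂ : ℝ) : ℝ :=
  ∫ z in β₁..β₂, z ^ (-1 - α) * (z - s) ^ α

end

/-! Let ψ be the Laplace exponent of L, so that E exp(r L(h)) = exp(h ψ(r)) for r in (-βn, βp). With
f(v) = exp(-b(t - v)), the integral Z(t) is the almost sure limit of the sums Σ f(t_{k+1})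
(L(t_{k+1}) - L(t_k)) over uniform grids. Independence and stationarity of the increments turn the
moment generating function of such a sum into exp(Σ (t_{k+1} - t_k) ψ(s f(t_{k+1}))), which tends to
exp ∫ ψ(s f(v)) dv. The substitution z = β exp(bv) turns this last integral into the two values of
`tildeI`.

Three points need care. The hypothesis on the law is a characteristic function on the real line,
whereas ψ concerns real exponents: the law is approximated weakly by compound Poisson laws without
small jumps, whose moments are explicit series. Exponential moments do not pass to weak limits in
general: since (-βn, βp) is open, moments of order p s with some p > 1 are also bounded, and
`lintegral_exp_eq_of_tendsto` applies, both to these laws and to the sums. Finally, the pathwise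
integral is meaningful because E|L(h)| ≤ h ∫ |x| dν, which bounds the expected grid variations
uniformly; Fatou and right-continuity then give paths of bounded variation. -/

/-! ### Compound Poisson laws and their moments -/

/-- The `k`-fold convolution of a measure with itself. -/
noncomputable def convPow (ν : Measure ℝ) : ℕ → Measure ℝ
  | 0 => Measure.dirac 0
  | k + 1 => ν.conv (convPow ν k)

instance isFiniteMeasure_convPow (ν : Measure ℝ) [IsFiniteMeasure ν] (k : ℕ) :
    IsFiniteMeasure (convPow ν k) := by
  induction k with
  | zero => rw [convPow]; infer_instance
  | succ k ih => rw [convPow]; infer_instance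

lemma lintegral_exp_convPow (ν : Measure ℝ) [IsFiniteMeasure ν] (s : ℝ) (k : ℕ) :
    ∫⁻ x, ENNReal.ofReal (Real.exp (s * x)) ∂(convPow ν k) =
      (∫⁻ x, ENNReal.ofReal (Real.exp (s * x)) ∂ν) ^ k := by
  have hm : Measurable fun x : ℝ => ENNReal.ofReal (Real.exp (s * x)) := by fun_prop
  induction k with
  | zero => rw [convPow, lintegral_dirac' _ hm]; simp
  | succ k ih =>
    rw [convPow, Measure.lintegral_conv hm, pow_succ', ← ih]
    simp_rw [mul_add, Real.exp_add, ENNReal.ofReal_mul (Real.exp_nonneg _)]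
    simp_rw [lintegral_const_mul _ hm]
    rw [lintegral_mul_const _ hm]

lemma convPow_univ (ν : Measure ℝ) [IsFiniteMeasure ν] (k : ℕ) :
    convPow ν k univ = ν univ ^ k := by
  simpa using lintegral_exp_convPow ν 0 k

/-- Triangle inequality for a sum of k + 1 variables, each contributing its first moment times the
mass of the k others. The factor k + 1 later cancels against the factorial in the Poisson weight. -/
lemma lintegral_enorm_convPow_le (ν : Measure ℝ) [IsFiniteMeasure ν] (k : ℕ) :
    ∫⁻ x, ‖x‖ₑ ∂(convPow ν (k + 1)) ≤ (k + 1) * ν univ ^ k * ∫⁻ x, ‖x‖ₑ ∂ν := by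
  have key : ∀ k, ∫⁻ x, ‖x‖ₑ ∂(convPow ν (k + 1)) ≤
      ν univ ^ k * (∫⁻ x, ‖x‖ₑ ∂ν) + ν univ * ∫⁻ x, ‖x‖ₑ ∂(convPow ν k) := by
    intro k
    rw [convPow, Measure.lintegral_conv (by fun_prop)]
    calc _ ≤ ∫⁻ x, ∫⁻ y, (‖x‖ₑ + ‖y‖ₑ) ∂(convPow ν k) ∂ν := by
          gcongr with x y
          exact enorm_add_le x y
      _ = _ := by
          simp_rw [lintegral_add_right _ (measurable_enorm : Measurable fun y : ℝ => ‖y‖ₑ),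
            lintegral_const, convPow_univ]
          rw [lintegral_add_right _ measurable_const, lintegral_mul_const _ (by fun_prop),
            lintegral_const]
          ring
  induction k with
  | zero =>
    refine (key 0).trans (le_of_eq ?_)
    simp [convPow]
  | succ k ih =>
    refine (key (k + 1)).trans ?_
    grw [ih]
    push_cast
    apply le_of_eq
    ring

lemma charFun_convPow (ν : Measure ℝ) [IsFiniteMeasure ν] (k : ℕ) (u : ℝ) :
    charFun (convPow ν k) u = charFun ν u ^ k := by
  induction k with
  | zero => rw [convPow]; simp
  | succ k ih => rw [convPow, charFun_conv, ih, pow_succ']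

/-- The compound Poisson law with finite Lévy measure `ν`. -/
noncomputable def compoundPoisson (ν : Measure ℝ) : Measure ℝ :=
  Measure.sum fun k : ℕ => ENNReal.ofReal (Real.exp (-ν.real univ) / k.factorial) • convPow ν k

lemma lintegral_compoundPoisson (ν : Measure ℝ) (f : ℝ → ENNReal) :
    ∫⁻ x, f x ∂(compoundPoisson ν) =
      ∑' k : ℕ, ENNReal.ofReal (Real.exp (-ν.real univ) / k.factorial) *
        ∫⁻ x, f x ∂(convPow ν k) := by
  simp [compoundPoisson, lintegral_sum_measure]

lemma lintegral_exp_compoundPoisson (ν : Measure ℝ) [IsFiniteMeasure ν] (s : ℝ)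
    (hs : Integrable (fun x => Real.exp (s * x)) ν) :
    ∫⁻ x, ENNReal.ofReal (Real.exp (s * x)) ∂(compoundPoisson ν) =
      ENNReal.ofReal (Real.exp (∫ x, (Real.exp (s * x) - 1) ∂ν)) := by
  rw [integral_sub hs (integrable_const _), integral_const, lintegral_compoundPoisson]
  simp_rw [lintegral_exp_convPow]
  rw [← ofReal_integral_eq_lintegral_ofReal hs (ae_of_all _ fun x => Real.exp_nonneg _)]
  set m := ∫ x, Real.exp (s * x) ∂ν
  have hm : 0 ≤ m := integral_nonneg fun x => Real.exp_nonneg _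
  have h (k : ℕ) : ENNReal.ofReal (Real.exp (-ν.real univ) / k.factorial) * ENNReal.ofReal m ^ k
      = ENNReal.ofReal (Real.exp (-ν.real univ) * (m ^ k / k.factorial)) := by
    rw [← ENNReal.ofReal_pow hm, ← ENNReal.ofReal_mul (by positivity)]
    congr 1; ring
  have hsum : HasSum (fun k : ℕ => Real.exp (-ν.real univ) * (m ^ k / k.factorial))
      (Real.exp (-ν.real univ) * Real.exp m) := by
    rw [Real.exp_eq_exp_ℝ]
    exact (NormedSpace.expSeries_div_hasSum_exp m).mul_left _
  simp_rw [h]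
  rw [← ENNReal.ofReal_tsum_of_nonneg (fun k => by positivity) hsum.summable, hsum.tsum_eq,
    ← Real.exp_add]
  congr 2
  simp
  ring

instance isProbabilityMeasure_compoundPoisson (ν : Measure ℝ) [IsFiniteMeasure ν] :
    IsProbabilityMeasure (compoundPoisson ν) := by
  constructor
  simpa using lintegral_exp_compoundPoisson ν 0 (by simp)

lemma lintegral_enorm_compoundPoisson_le (ν : Measure ℝ) [IsFiniteMeasure ν] :
    ∫⁻ x, ‖x‖ₑ ∂(compoundPoisson ν) ≤ ∫⁻ x, ‖x‖ₑ ∂ν := by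
  have h0 : ∫⁻ x, ‖x‖ₑ ∂(convPow ν 0) = 0 := by simp [convPow]
  have h1 := measure_univ (μ := compoundPoisson ν)
  rw [← lintegral_one, lintegral_compoundPoisson] at h1
  rw [lintegral_compoundPoisson, tsum_eq_zero_add' ENNReal.summable, h0, mul_zero, zero_add]
  calc _ ≤ ∑' k : ℕ, ENNReal.ofReal (Real.exp (-ν.real univ) / k.factorial) * ν univ ^ k *
        ∫⁻ x, ‖x‖ₑ ∂ν := by
        refine ENNReal.tsum_le_tsum fun k => ?_
        grw [lintegral_enorm_convPow_le]
        rw [← mul_assoc, ← mul_assoc]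
        gcongr
        rw [← Nat.cast_add_one, ← ENNReal.ofReal_natCast, ← ENNReal.ofReal_mul (by positivity)]
        apply ENNReal.ofReal_le_ofReal
        rw [Nat.factorial_succ]
        push_cast
        apply le_of_eq
        field_simp
    _ = _ := by
        rw [ENNReal.tsum_mul_right]
        simp_rw [lintegral_one, convPow_univ] at h1
        rw [h1, one_mul]

lemma charFun_compoundPoisson (ν : Measure ℝ) [IsFiniteMeasure ν] (u : ℝ) :
    charFun (compoundPoisson ν) u =
      Complex.exp (∫ x : ℝ, (Complex.exp (Complex.I * u * x) - 1) ∂ν) := by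
  have hint : ∀ (μ : Measure ℝ) [IsFiniteMeasure μ],
      Integrable (fun x : ℝ => Complex.exp (u * x * Complex.I)) μ := by
    intro μ _
    refine (integrable_const (1 : ℝ)).mono (by fun_prop) (ae_of_all _ fun x => ?_)
    rw [← Complex.ofReal_mul, Complex.norm_exp_ofReal_mul_I]; simp
  have h1 : ∫ x : ℝ, (Complex.exp (Complex.I * u * x) - 1) ∂ν = charFun ν u - ν.real univ := by
    simp_rw [mul_assoc, mul_comm Complex.I]
    rw [integral_sub (hint ν) (integrable_const _), charFun_apply_real]
    simp
  rw [h1, charFun_apply_real, compoundPoisson, integral_sum_measure (hint (compoundPoisson ν))]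
  simp_rw [integral_smul_measure, ← charFun_apply_real, charFun_convPow]
  have hsum : HasSum (fun k : ℕ => Complex.exp (-ν.real univ) * (charFun ν u ^ k / k.factorial))
      (Complex.exp (-ν.real univ) * Complex.exp (charFun ν u)) := by
    have := NormedSpace.expSeries_div_hasSum_exp (charFun ν u)
    rw [← Complex.exp_eq_exp_ℂ] at this
    exact this.mul_left _
  rw [sub_eq_neg_add, Complex.exp_add, ← hsum.tsum_eq]
  congr 1 with k
  rw [ENNReal.toReal_ofReal (by positivity), Complex.real_smul]
  push_cast
  ring

/-! ### Exponential moments under weak convergence -/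

/-- Above the level M, one has y = y^(1-p) y^p ≤ M^(1-p) y^p. This makes the truncation error
uniformly small once p-th powers have bounded integrals. -/
lemma le_min_add_rpow_mul {y M p : ℝ} (hy : 0 < y) (hM : 0 < M) (hp : 1 < p) :
    y ≤ min y M + M ^ (1 - p) * y ^ p := by
  rcases le_or_gt y M with h | h
  · rw [min_eq_left h]
    have : 0 ≤ M ^ (1 - p) * y ^ p := by positivity
    linarith
  · have h1 : y = y ^ (1 - p) * y ^ p := by
      rw [← Real.rpow_add hy]; simp
    have h2 : y ^ (1 - p) ≤ M ^ (1 - p) :=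
      Real.rpow_le_rpow_of_nonpos hM h.le (by linarith)
    have h3 : 0 ≤ min y M := le_min hy.le hM.le
    calc y = y ^ (1 - p) * y ^ p := h1
      _ ≤ M ^ (1 - p) * y ^ p := by gcongr
      _ ≤ _ := by linarith

lemma lintegral_le_liminf_of_tendsto {μs : ℕ → ProbabilityMeasure ℝ} {μ : ProbabilityMeasure ℝ}
    (h : Tendsto μs atTop (𝓝 μ)) {f : ℝ → ℝ} (hf : Continuous f) (hf0 : 0 ≤ f) :
    ∫⁻ x, ENNReal.ofReal (f x) ∂(μ : Measure ℝ) ≤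
      atTop.liminf fun n => ∫⁻ x, ENNReal.ofReal (f x) ∂(μs n : Measure ℝ) :=
  lintegral_le_liminf_lintegral_of_forall_isOpen_measure_le_liminf_measure hf hf0
    fun _ hG => ProbabilityMeasure.le_liminf_measure_open_of_tendsto h hG

/-- Convergence of exponential moments under weak convergence, from a bound on exponential moments
of a higher order. -/
lemma lintegral_exp_eq_of_tendsto {μs : ℕ → ProbabilityMeasure ℝ} {μ : ProbabilityMeasure ℝ}
    (h : Tendsto μs atTop (𝓝 μ)) {s p : ℝ} (hp : 1 < p) {C c : ENNReal} (hC : C ≠ ⊤)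
    (hb : ∀ᶠ n in atTop, ∫⁻ x, ENNReal.ofReal (Real.exp (p * s * x)) ∂(μs n : Measure ℝ) ≤ C)
    (hc : Tendsto (fun n => ∫⁻ x, ENNReal.ofReal (Real.exp (s * x)) ∂(μs n : Measure ℝ)) atTop
      (𝓝 c)) :
    ∫⁻ x, ENNReal.ofReal (Real.exp (s * x)) ∂(μ : Measure ℝ) = c := by
  refine le_antisymm ?_ ?_
  · rw [← hc.liminf_eq]
    exact lintegral_le_liminf_of_tendsto h (by fun_prop) fun x => Real.exp_nonneg _
  -- Truncation at M = m + 1: the truncated exponential is a bounded continuous test function, and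
  -- the excess is at most M^(1-p) C, which vanishes as m grows.
  have key (m : ℕ) : c ≤ ∫⁻ x, ENNReal.ofReal (Real.exp (s * x)) ∂(μ : Measure ℝ) +
      ENNReal.ofReal (((m : ℝ) + 1) ^ (1 - p)) * C := by
    have hM : (0 : ℝ) < (m : ℝ) + 1 := by positivity
    let g : BoundedContinuousFunction ℝ ℝ≥0 := BoundedContinuousFunction.mkOfBound
      ⟨fun x => min (Real.toNNReal (Real.exp (s * x))) (m + 1), by fun_prop⟩ (m + 1) (by
        intro x y
        have hx : min (Real.toNNReal (Real.exp (s * x))) ((m : ℝ≥0) + 1) ≤ m + 1 := min_le_right _ _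
        have hy : min (Real.toNNReal (Real.exp (s * y))) ((m : ℝ≥0) + 1) ≤ m + 1 := min_le_right _ _
        rw [NNReal.dist_eq, abs_sub_le_iff]
        have hx' := NNReal.coe_le_coe.2 hx
        have hy' := NNReal.coe_le_coe.2 hy
        push_cast at hx' hy'
        constructor <;> simp only [ContinuousMap.coe_mk, NNReal.coe_min] <;> push_cast
        · have : 0 ≤ min (↑(Real.exp (s * y)).toNNReal) ((m : ℝ) + 1) := le_min (by positivity) hM.le
          linarith
        · have : 0 ≤ min (↑(Real.exp (s * x)).toNNReal) ((m : ℝ) + 1) := le_min (by positivity) hM.le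
          linarith)
    have hg (x : ℝ) : (g x : ENNReal) = ENNReal.ofReal (min (Real.exp (s * x)) (m + 1)) := by
      change ((min (Real.toNNReal (Real.exp (s * x))) (m + 1) : ℝ≥0) : ENNReal) =
        ((min (Real.exp (s * x)) (m + 1)).toNNReal : ENNReal)
      congr 1
      rw [(show Monotone Real.toNNReal from fun _ _ => Real.toNNReal_le_toNNReal).map_min, Real.toNNReal_add (by positivity) zero_le_one]
      simp
    have hlim := ProbabilityMeasure.tendsto_iff_forall_lintegral_tendsto.1 h g
    have hle : c ≤ ∫⁻ x, g x ∂(μ : Measure ℝ) + ENNReal.ofReal (((m : ℝ) + 1) ^ (1 - p)) * C := by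
      refine le_of_tendsto_of_tendsto hc (hlim.add_const _) ?_
      filter_upwards [hb] with n hn
      calc ∫⁻ x, ENNReal.ofReal (Real.exp (s * x)) ∂(μs n : Measure ℝ)
          ≤ ∫⁻ x, (g x + ENNReal.ofReal (((m : ℝ) + 1) ^ (1 - p)) *
              ENNReal.ofReal (Real.exp (p * s * x))) ∂(μs n : Measure ℝ) := by
            refine lintegral_mono fun x => ?_
            rw [hg, ← ENNReal.ofReal_mul (by positivity), ← ENNReal.ofReal_add (by positivity)
              (by positivity)]
            apply ENNReal.ofReal_le_ofReal
            refine (le_min_add_rpow_mul (Real.exp_pos (s * x)) hM hp).trans (le_of_eq ?_)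
            rw [← Real.exp_mul]
            ring_nf
        _ ≤ _ := by
            rw [lintegral_add_right _ (by fun_prop), lintegral_const_mul _ (by fun_prop)]
            gcongr
    refine hle.trans ?_
    gcongr with x
    rw [hg]
    exact ENNReal.ofReal_le_ofReal (min_le_left _ _)
  have hlim : Tendsto (fun m : ℕ => ∫⁻ x, ENNReal.ofReal (Real.exp (s * x)) ∂(μ : Measure ℝ) +
      ENNReal.ofReal (((m : ℝ) + 1) ^ (1 - p)) * C) atTop
      (𝓝 (∫⁻ x, ENNReal.ofReal (Real.exp (s * x)) ∂(μ : Measure ℝ) + ENNReal.ofReal 0 * C)) := by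
    refine Tendsto.const_add _ (ENNReal.Tendsto.mul_const (ENNReal.tendsto_ofReal ?_) (Or.inr hC))
    have := (tendsto_rpow_neg_atTop (y := p - 1) (by linarith)).comp
      (tendsto_atTop_add_const_right _ (1 : ℝ) tendsto_natCast_atTop_atTop)
    simpa [Function.comp_def] using this
  simpa using ge_of_tendsto' hlim key

/-! ### Laws given by a Lévy-Khintchine formula -/

section LevyKhintchine

variable {ν : Measure ℝ}

lemma finite_restrict_abs_gt (hν : Integrable (fun x => x) ν) {ε : ℝ} (hε : 0 < ε) :
    IsFiniteMeasure (ν.restrict {x | ε < |x|}) := by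
  constructor
  rw [Measure.restrict_apply_univ]
  refine (measure_mono fun x (hx : ε < |x|) => ?_).trans_lt (hν.norm.measure_ge_lt_top hε)
  exact hx.le

/-- Dominated convergence. The cut-off sets exhaust everything but the origin, hence the condition f
0 = 0. -/
lemma tendsto_integral_restrict_abs_gt {E : Type*} [NormedAddCommGroup E] [NormedSpace ℝ E]
    {f : ℝ → E} (hf : Integrable f ν) (hf0 : f 0 = 0) :
    Tendsto (fun n : ℕ => ∫ x in {x | 1 / ((n : ℝ) + 1) < |x|}, f x ∂ν) atTop
      (𝓝 (∫ x, f x ∂ν)) := by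
  have hm (n : ℕ) : MeasurableSet {x : ℝ | 1 / ((n : ℝ) + 1) < |x|} :=
    measurableSet_lt measurable_const (by fun_prop)
  simp_rw [← integral_indicator (hm _)]
  refine tendsto_integral_of_dominated_convergence (fun x => ‖f x‖)
    (fun n => hf.aestronglyMeasurable.indicator (hm n)) hf.norm
    (fun n => ae_of_all _ fun x => norm_indicator_le_norm_self _ _) (ae_of_all _ fun x => ?_)
  rcases eq_or_ne x 0 with rfl | hx
  · refine tendsto_const_nhds.congr fun n => ?_
    rw [indicator_apply, hf0, ite_self]
  · refine tendsto_const_nhds.congr' ?_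
    filter_upwards [tendsto_one_div_add_atTop_nhds_zero_nat.eventually_lt_const (abs_pos.2 hx)]
      with n hn
    exact (indicator_of_mem (s := {x : ℝ | 1 / ((n : ℝ) + 1) < |x|}) hn f).symm

lemma integrable_cexp_sub_one (hν : Integrable (fun x => x) ν) (u : ℝ) :
    Integrable (fun x : ℝ => Complex.exp (Complex.I * u * x) - 1) ν := by
  refine (hν.norm.const_mul |u|).mono' (by fun_prop) (ae_of_all _ fun x => ?_)
  have := Real.norm_exp_I_mul_ofReal_sub_one_le (x := u * x)
  rw [Complex.ofReal_mul, ← mul_assoc] at this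
  simpa [abs_mul] using this

/-- A probability measure given by a Lévy-Khintchine formula without drift and Gaussian part is a
weak limit of the compound Poisson laws obtained by cutting off the small jumps. -/
lemma tendsto_compoundPoisson (hν : Integrable (fun x => x) ν) (μ : ProbabilityMeasure ℝ)
    (hμ : ∀ u : ℝ, charFun (μ : Measure ℝ) u =
      Complex.exp (∫ x : ℝ, (Complex.exp (Complex.I * u * x) - 1) ∂ν)) :
    ∃ νs : ℕ → Measure ℝ, ∃ πs : ℕ → ProbabilityMeasure ℝ,
      (∀ n, νs n = ν.restrict {x | 1 / ((n : ℝ) + 1) < |x|}) ∧ (∀ n, IsFiniteMeasure (νs n)) ∧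
      (∀ n, (πs n : Measure ℝ) = compoundPoisson (νs n)) ∧ Tendsto πs atTop (𝓝 μ) := by
  have hfin (n : ℕ) : IsFiniteMeasure (ν.restrict {x | 1 / ((n : ℝ) + 1) < |x|}) :=
    finite_restrict_abs_gt hν (by positivity)
  refine ⟨fun n => ν.restrict {x | 1 / ((n : ℝ) + 1) < |x|},
    fun n => ⟨compoundPoisson (ν.restrict {x | 1 / ((n : ℝ) + 1) < |x|}), inferInstance⟩,
    fun n => rfl, hfin, fun n => rfl, ?_⟩
  refine ProbabilityMeasure.tendsto_of_tendsto_charFun fun u => ?_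
  rw [hμ]
  simp_rw [ProbabilityMeasure.coe_mk, charFun_compoundPoisson]
  exact (Complex.continuous_exp.tendsto _).comp
    (tendsto_integral_restrict_abs_gt (integrable_cexp_sub_one hν u) (by simp))

/-- The compound Poisson bound is uniform in the cut-off, and weak limits can only lower the first
absolute moment. -/
lemma lintegral_enorm_le_of_charFun (hν : Integrable (fun x => x) ν) (μ : Measure ℝ)
    [hp : IsProbabilityMeasure μ] (hμ : ∀ u : ℝ, charFun μ u =
      Complex.exp (∫ x : ℝ, (Complex.exp (Complex.I * u * x) - 1) ∂ν)) :
    ∫⁻ x, ‖x‖ₑ ∂μ ≤ ∫⁻ x, ‖x‖ₑ ∂ν := by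
  obtain ⟨νs, πs, hνs, hfin, hπs, hlim⟩ := tendsto_compoundPoisson hν ⟨μ, hp⟩ hμ
  have h := lintegral_le_liminf_of_tendsto hlim continuous_abs fun x => abs_nonneg x
  simp_rw [← Real.norm_eq_abs, ofReal_norm] at h
  refine h.trans (liminf_le_of_frequently_le' (Frequently.of_forall fun n => ?_))
  rw [hπs, hνs]
  have := hfin n
  rw [hνs] at this
  exact (lintegral_enorm_compoundPoisson_le _).trans (setLIntegral_le_lintegral _ _)

lemma lintegral_exp_eq_of_charFun (hν : Integrable (fun x => x) ν) (μ : Measure ℝ)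
    [hprob : IsProbabilityMeasure μ] (hμ : ∀ u : ℝ, charFun μ u =
      Complex.exp (∫ x : ℝ, (Complex.exp (Complex.I * u * x) - 1) ∂ν))
    {s p : ℝ} (hp : 1 < p) (hs : Integrable (fun x => Real.exp (s * x) - 1) ν)
    (hps : Integrable (fun x => Real.exp (p * s * x) - 1) ν) :
    ∫⁻ x, ENNReal.ofReal (Real.exp (s * x)) ∂μ =
      ENNReal.ofReal (Real.exp (∫ x, (Real.exp (s * x) - 1) ∂ν)) := by
  obtain ⟨νs, πs, hνs, hfin, hπs, hlim⟩ := tendsto_compoundPoisson hν ⟨μ, hprob⟩ hμ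
  have hform (r : ℝ) (hr : Integrable (fun x => Real.exp (r * x) - 1) ν) (n : ℕ) :
      ∫⁻ x, ENNReal.ofReal (Real.exp (r * x)) ∂(πs n : Measure ℝ) =
        ENNReal.ofReal (Real.exp (∫ x in {x | 1 / ((n : ℝ) + 1) < |x|},
          (Real.exp (r * x) - 1) ∂ν)) := by
    have := hfin n
    rw [hπs, lintegral_exp_compoundPoisson, hνs]
    have h1 : Integrable (fun x => Real.exp (r * x) - 1) (νs n) := by
      rw [hνs]; exact hr.restrict
    simpa [Pi.add_def] using h1.add (integrable_const (1 : ℝ))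
  refine lintegral_exp_eq_of_tendsto (μ := ⟨μ, hprob⟩)
    -- The absolute value makes the bound independent of the cut-off.
    (C := ENNReal.ofReal (Real.exp (∫ x, |Real.exp (p * s * x) - 1| ∂ν))) hlim hp
    ENNReal.ofReal_ne_top (Eventually.of_forall fun n => ?_) ?_
  · rw [hform _ hps]
    apply ENNReal.ofReal_le_ofReal
    apply Real.exp_le_exp.2
    refine (integral_mono hps.restrict hps.abs.restrict fun x => le_abs_self _).trans ?_
    exact setIntegral_le_integral hps.abs (ae_of_all _ fun x => abs_nonneg _)
  · simp_rw [hform s hs]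
    refine ENNReal.tendsto_ofReal ((Real.continuous_exp.tendsto _).comp ?_)
    exact tendsto_integral_restrict_abs_gt hs (by simp)

end LevyKhintchine

/-! ### The one-sided Lévy integral -/

lemma abs_exp_sub_exp_le (a b : ℝ) :
    |Real.exp a - Real.exp b| ≤ |a - b| * (Real.exp a + Real.exp b) := by
  have key : ∀ a b : ℝ, b ≤ a → |Real.exp a - Real.exp b| ≤ |a - b| * (Real.exp a + Real.exp b) := by
    intro a b hab
    rw [abs_of_nonneg (sub_nonneg.2 (Real.exp_le_exp.2 hab)), abs_of_nonneg (sub_nonneg.2 hab)]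
    have h1 : Real.exp b = Real.exp a * Real.exp (b - a) := by rw [← Real.exp_add]; ring_nf
    have h2 : b - a + 1 ≤ Real.exp (b - a) := Real.add_one_le_exp _
    have h3 := mul_le_mul_of_nonneg_left h2 (Real.exp_nonneg a)
    have h4 : 0 ≤ (a - b) * Real.exp b := mul_nonneg (sub_nonneg.2 hab) (Real.exp_nonneg b)
    linarith
  rcases le_total b a with h | h
  · exact key a b h
  · rw [abs_sub_comm, abs_sub_comm a b, add_comm]
    exact key b a h

section OneSided

variable {α β γ : ℝ}

lemma integrableOn_rpow_neg_mul_exp (hα : α < 1) (hβ : 0 < β) :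
    IntegrableOn (fun x : ℝ => x ^ (-α) * Real.exp (-(β * x))) (Ioi 0) := by
  have := integrableOn_rpow_mul_exp_neg_mul_rpow (p := 1) (s := -α) (b := β) (by linarith)
    one_pos hβ
  simpa using this

lemma integral_rpow_neg_mul_exp (hα : α < 1) (hβ : 0 < β) :
    ∫ x : ℝ in Ioi 0, β * (x ^ (-α) * Real.exp (-(β * x))) = β ^ α * Real.Gamma (1 - α) := by
  have := Real.integral_rpow_mul_exp_neg_mul_Ioi (a := 1 - α) (by linarith) hβ
  rw [show 1 - α - 1 = -α by ring] at this
  rw [integral_const_mul, this, one_div, Real.inv_rpow hβ.le, ← Real.rpow_neg hβ.le, ← mul_assoc]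
  congr 1
  nth_rewrite 1 [← Real.rpow_one β]
  rw [← Real.rpow_add hβ]
  ring_nf

/-- The difference of exponentials is O(x) at 0, which improves x^(-1-α) to the integrable x^(-α);
for 0 < α < 1 neither term is integrable alone. -/
lemma integrableOn_rpow_mul_exp_sub_exp (hα : α < 1) (hβ : 0 < β) (hγ : 0 < γ) :
    IntegrableOn (fun x : ℝ => x ^ (-1 - α) * (Real.exp (-(γ * x)) - Real.exp (-(β * x))))
      (Ioi 0) := by
  have h := ((integrableOn_rpow_neg_mul_exp hα hγ).add
    (integrableOn_rpow_neg_mul_exp hα hβ)).const_mul |β - γ|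
  refine Integrable.mono' h (by fun_prop) ?_
  filter_upwards [ae_restrict_mem measurableSet_Ioi] with x (hx : 0 < x)
  have h1 := abs_exp_sub_exp_le (-(γ * x)) (-(β * x))
  rw [show -(γ * x) - -(β * x) = (β - γ) * x by ring, abs_mul, abs_of_pos hx] at h1
  have h2 : x ^ (-α) = x ^ (-1 - α) * x := by
    rw [← Real.rpow_add_one hx.ne']; ring_nf
  rw [norm_mul, Real.norm_of_nonneg (by positivity), Real.norm_eq_abs, Pi.add_apply, h2]
  calc _ ≤ _ := mul_le_mul_of_nonneg_left h1 (by positivity)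
    _ = _ := by ring

/-- Integration by parts: the function G vanishes at 0 and at infinity, so its derivative integrates
to zero. This expresses α times the integral through two Gamma integrals. -/
lemma integral_rpow_mul_exp_sub_exp (hα : α < 1) (hα0 : α ≠ 0) (hβ : 0 < β) (hγ : 0 < γ) :
    ∫ x : ℝ in Ioi 0, x ^ (-1 - α) * (Real.exp (-(γ * x)) - Real.exp (-(β * x))) =
      -(Real.Gamma (1 - α) / α) * (γ ^ α - β ^ α) := by
  let G : ℝ → ℝ := fun x => x ^ (-α) * (Real.exp (-(γ * x)) - Real.exp (-(β * x)))
  have hI := integrableOn_rpow_mul_exp_sub_exp hα hβ hγ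
  have hIβ := (integrableOn_rpow_neg_mul_exp hα hβ).const_mul β
  have hIγ := (integrableOn_rpow_neg_mul_exp hα hγ).const_mul γ
  have hderiv : ∀ x ∈ Ioi (0 : ℝ), HasDerivAt G
      ((-α) * (x ^ (-1 - α) * (Real.exp (-(γ * x)) - Real.exp (-(β * x)))) +
        (β * (x ^ (-α) * Real.exp (-(β * x))) - γ * (x ^ (-α) * Real.exp (-(γ * x))))) x := by
    intro x (hx : 0 < x)
    have h1 := Real.hasDerivAt_rpow_const (x := x) (p := -α) (Or.inl hx.ne')
    have he (c : ℝ) : HasDerivAt (fun x : ℝ => Real.exp (-(c * x)))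
        (Real.exp (-(c * x)) * -(c * 1)) x := (((hasDerivAt_id x).const_mul c).neg).exp
    convert! h1.mul ((he γ).sub (he β)) using 1
    rw [show -α - 1 = -1 - α by ring, Pi.sub_apply]
    ring
  have hcont : ContinuousWithinAt G (Ici 0) 0 := by
    have hG0 : G 0 = 0 := by simp [G]
    rw [ContinuousWithinAt, hG0]
    have hlim : Tendsto (fun x : ℝ => |β - γ| * (x ^ (1 - α) * 2)) (𝓝[≥] 0) (𝓝 0) := by
      have : Continuous fun x : ℝ => |β - γ| * (x ^ (1 - α) * 2) := by
        have := Real.continuous_rpow_const (q := 1 - α) (by linarith)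
        fun_prop
      have h := (this.tendsto 0).mono_left (nhdsWithin_le_nhds (s := Ici 0))
      rwa [Real.zero_rpow (by linarith), zero_mul, mul_zero] at h
    refine squeeze_zero_norm' ?_ hlim
    filter_upwards [self_mem_nhdsWithin] with x (hx : 0 ≤ x)
    rcases hx.eq_or_lt with rfl | hx
    · rw [hG0]
      simp only [norm_zero]
      positivity
    have h1 := abs_exp_sub_exp_le (-(γ * x)) (-(β * x))
    rw [show -(γ * x) - -(β * x) = (β - γ) * x by ring, abs_mul, abs_of_pos hx] at h1
    have h2 : x ^ (1 - α) = x ^ (-α) * x := by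
      rw [← Real.rpow_add_one hx.ne']; ring_nf
    have h3 (c : ℝ) (hc : 0 < c) : Real.exp (-(c * x)) ≤ 1 := by
      rw [Real.exp_le_one_iff]; have := mul_pos hc hx; linarith
    rw [norm_mul, Real.norm_of_nonneg (by positivity), Real.norm_eq_abs, h2]
    calc _ ≤ x ^ (-α) * (|β - γ| * x * (Real.exp (-(γ * x)) + Real.exp (-(β * x)))) :=
          mul_le_mul_of_nonneg_left h1 (by positivity)
      _ ≤ x ^ (-α) * (|β - γ| * x * (1 + 1)) := by
          gcongr
          · exact h3 γ hγ
          · exact h3 β hβ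
      _ = _ := by ring
  have hlim : Tendsto G atTop (𝓝 0) := by
    have h1 := (tendsto_rpow_mul_exp_neg_mul_atTop_nhds_zero (-α) γ hγ).sub
      (tendsto_rpow_mul_exp_neg_mul_atTop_nhds_zero (-α) β hβ)
    rw [sub_zero] at h1
    refine h1.congr fun x => ?_
    simp only [G, mul_sub, neg_mul]
  have h := integral_Ioi_of_hasDerivAt_of_tendsto hcont hderiv
    ((hI.const_mul (-α)).add (hIβ.sub hIγ)) hlim
  have hG0 : G 0 = 0 := by simp [G]
  have hIβγ : Integrable (fun x => β * (x ^ (-α) * Real.exp (-(β * x))) -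
      γ * (x ^ (-α) * Real.exp (-(γ * x)))) (volume.restrict (Ioi 0)) := hIβ.sub hIγ
  rw [integral_add (hI.const_mul (-α)) hIβγ, integral_sub hIβ hIγ, integral_const_mul,
    integral_rpow_neg_mul_exp hα hβ, integral_rpow_neg_mul_exp hα hγ, hG0] at h
  apply mul_left_cancel₀ hα0
  have h1 : α * (-(Real.Gamma (1 - α) / α) * (γ ^ α - β ^ α)) =
      -(Real.Gamma (1 - α) * (γ ^ α - β ^ α)) := by field_simp
  rw [h1]
  linarith

end OneSided

/-! ### The BCTS Lévy measure and its Laplace exponent -/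

section BCTS

variable {αp αn βp βn cp cn : ℝ}

lemma measurable_bctsDensity : Measurable (bctsDensity αp αn βp βn cp cn) :=
  Measurable.ite measurableSet_Ici (by fun_prop) (by fun_prop)

lemma bctsDensity_nonneg (hcp : 0 ≤ cp) (hcn : 0 ≤ cn) (x : ℝ) :
    0 ≤ bctsDensity αp αn βp βn cp cn x := by
  unfold bctsDensity
  split_ifs <;> positivity

lemma bctsLevyMeasure_mul (h : ℝ≥0) :
    bctsLevyMeasure αp αn βp βn (cp * h) (cn * h) = h • bctsLevyMeasure αp αn βp βn cp cn := by
  have hs : (h • bctsLevyMeasure αp αn βp βn cp cn) =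
      (h : ENNReal) • bctsLevyMeasure αp αn βp βn cp cn := rfl
  rw [hs, bctsLevyMeasure, bctsLevyMeasure,
    ← withDensity_smul _ (measurable_bctsDensity.ennreal_ofReal)]
  congr 1
  ext x
  rw [Pi.smul_apply, smul_eq_mul, ← ENNReal.ofReal_coe_nnreal, ← ENNReal.ofReal_mul h.coe_nonneg]
  congr 1
  unfold bctsDensity
  split_ifs <;> ring

/-- Integration against the BCTS Lévy measure, reduced to integrals over the half-line. -/
lemma integrable_bctsLevyMeasure (hcp : 0 ≤ cp) (hcn : 0 ≤ cn) {g : ℝ → ℝ}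
    (hp : IntegrableOn (fun x => x ^ (-1 - αp) * (Real.exp (-(βp * x)) * g x)) (Ioi 0))
    (hn : IntegrableOn (fun x => x ^ (-1 - αn) * (Real.exp (-(βn * x)) * g (-x))) (Ioi 0)) :
    Integrable g (bctsLevyMeasure αp αn βp βn cp cn) ∧
      ∫ x, g x ∂(bctsLevyMeasure αp αn βp βn cp cn) =
        cp * (∫ x in Ioi 0, x ^ (-1 - αp) * (Real.exp (-(βp * x)) * g x)) +
        cn * ∫ x in Ioi 0, x ^ (-1 - αn) * (Real.exp (-(βn * x)) * g (-x)) := by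
  have hm : Measurable fun x => ENNReal.ofReal (bctsDensity αp αn βp βn cp cn x) :=
    measurable_bctsDensity.ennreal_ofReal
  have hlt : ∀ᵐ x ∂(volume : Measure ℝ),
      ENNReal.ofReal (bctsDensity αp αn βp βn cp cn x) < ⊤ :=
    ae_of_all _ fun _ => ENNReal.ofReal_lt_top
  rw [bctsLevyMeasure, integrable_withDensity_iff_integrable_smul' hm hlt,
    integral_withDensity_eq_integral_toReal_smul hm hlt]
  simp_rw [ENNReal.toReal_ofReal (bctsDensity_nonneg hcp hcn _), smul_eq_mul]
  have hinv {x α : ℝ} (hx : 0 < x) : x ^ (-1 - α) = (x ^ (1 + α))⁻¹ := by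
    rw [← Real.rpow_neg hx.le]; ring_nf
  have ep : EqOn (fun x => bctsDensity αp αn βp βn cp cn x * g x)
      (fun x => cp * (x ^ (-1 - αp) * (Real.exp (-(βp * x)) * g x))) (Ioi 0) := by
    intro x (hx : 0 < x)
    simp only [bctsDensity, hx.le, if_true, hinv hx]
    ring
  have en : EqOn (fun x => bctsDensity αp αn βp βn cp cn (-x) * g (-x))
      (fun x => cn * (x ^ (-1 - αn) * (Real.exp (-(βn * x)) * g (-x)))) (Ioi 0) := by
    intro x (hx : 0 < x)
    simp only [bctsDensity, neg_nonneg, not_le.2 hx, if_false, hinv hx, abs_neg, abs_of_pos hx,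
      mul_neg]
    ring
  have ip : IntegrableOn (fun x => bctsDensity αp αn βp βn cp cn x * g x) (Ioi 0) :=
    (integrableOn_congr_fun ep measurableSet_Ioi).2 (hp.const_mul cp)
  have i_n : IntegrableOn (fun x => bctsDensity αp αn βp βn cp cn x * g x) (Iic 0) := by
    have := (integrableOn_congr_fun en measurableSet_Ioi).2 (hn.const_mul cn)
    rw [integrableOn_Iic_iff_integrableOn_Iio]
    rw [← neg_zero] at this
    simpa using this.comp_neg_Iio
  have hI : Integrable (fun x => bctsDensity αp αn βp βn cp cn x * g x) := by
    rw [← integrableOn_univ, ← Iic_union_Ioi (a := (0 : ℝ))]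
    exact i_n.union ip
  refine ⟨hI, ?_⟩
  rw [← integral_add_compl (measurableSet_Ioi (a := (0 : ℝ))) hI, compl_Ioi,
    setIntegral_congr_fun measurableSet_Ioi ep, integral_const_mul]
  have h0 := integral_comp_neg_Ioi 0 (fun x => bctsDensity αp αn βp βn cp cn x * g x)
  rw [neg_zero] at h0
  rw [← h0, setIntegral_congr_fun measurableSet_Ioi en, integral_const_mul]

lemma integrable_id_bctsLevyMeasure (hαp : αp < 1) (hαn : αn < 1) (hβp : 0 < βp) (hβn : 0 < βn)
    (hcp : 0 ≤ cp) (hcn : 0 ≤ cn) :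
    Integrable (fun x => x) (bctsLevyMeasure αp αn βp βn cp cn) := by
  have h {α x : ℝ} (hx : 0 < x) : x ^ (-α) = x ^ (-1 - α) * x := by
    rw [← Real.rpow_add_one hx.ne']; ring_nf
  refine (integrable_bctsLevyMeasure hcp hcn
    ((integrableOn_rpow_neg_mul_exp hαp hβp).congr_fun (fun x hx => ?_) measurableSet_Ioi)
    ((integrableOn_rpow_neg_mul_exp hαn hβn).neg.congr_fun (fun x hx => ?_) measurableSet_Ioi)).1
  · simp only [h (mem_Ioi.1 hx)]; ring
  · simp only [Pi.neg_apply, h (mem_Ioi.1 hx)]; ring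

/-- The Laplace exponent of the BCTS law. -/
noncomputable def bctsExponent (αp αn βp βn cp cn s : ℝ) : ℝ :=
  -(cp * (Real.Gamma (1 - αp) / αp) * ((βp - s) ^ αp - βp ^ αp)) -
    cn * (Real.Gamma (1 - αn) / αn) * ((βn + s) ^ αn - βn ^ αn)

/-- Multiplying the tempering factor by exp(s x) - 1 gives a difference of two exponentials, with
rates β ∓ s and β, on each half-line. -/
lemma integral_exp_sub_one_bctsLevyMeasure (hαp : αp < 1) (hαp0 : αp ≠ 0) (hαn : αn < 1)
    (hαn0 : αn ≠ 0) (hβp : 0 < βp) (hβn : 0 < βn) (hcp : 0 ≤ cp) (hcn : 0 ≤ cn)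
    {s : ℝ} (hs : -βn < s) (hs' : s < βp) :
    Integrable (fun x => Real.exp (s * x) - 1) (bctsLevyMeasure αp αn βp βn cp cn) ∧
      ∫ x, (Real.exp (s * x) - 1) ∂(bctsLevyMeasure αp αn βp βn cp cn) =
        bctsExponent αp αn βp βn cp cn s := by
  have e1 (x : ℝ) : x ^ (-1 - αp) * (Real.exp (-((βp - s) * x)) - Real.exp (-(βp * x))) =
      x ^ (-1 - αp) * (Real.exp (-(βp * x)) * (Real.exp (s * x) - 1)) := by
    rw [mul_sub (Real.exp _), ← Real.exp_add, mul_one]; ring_nf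
  have e2 (x : ℝ) : x ^ (-1 - αn) * (Real.exp (-((βn + s) * x)) - Real.exp (-(βn * x))) =
      x ^ (-1 - αn) * (Real.exp (-(βn * x)) * (Real.exp (s * -x) - 1)) := by
    rw [mul_sub (Real.exp _), ← Real.exp_add, mul_one]; ring_nf
  have hp := integrableOn_rpow_mul_exp_sub_exp hαp hβp (show 0 < βp - s by linarith)
  have hn := integrableOn_rpow_mul_exp_sub_exp hαn hβn (show 0 < βn + s by linarith)
  have vp := integral_rpow_mul_exp_sub_exp hαp hαp0 hβp (show 0 < βp - s by linarith)
  have vn := integral_rpow_mul_exp_sub_exp hαn hαn0 hβn (show 0 < βn + s by linarith)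
  simp_rw [e1] at hp vp
  simp_rw [e2] at hn vn
  obtain ⟨h1, h2⟩ := integrable_bctsLevyMeasure (g := fun x => Real.exp (s * x) - 1) hcp hcn hp hn
  refine ⟨h1, h2.trans ?_⟩
  rw [vp, vn, bctsExponent]
  ring

lemma continuousOn_bctsExponent :
    ContinuousOn (bctsExponent αp αn βp βn cp cn) (Ioo (-βn) βp) := by
  have h1 : ContinuousOn (fun s => (βp - s) ^ αp) (Ioo (-βn) βp) :=
    ContinuousOn.rpow_const (by fun_prop) fun x hx => Or.inl (by have := hx.2; linarith)
  have h2 : ContinuousOn (fun s => (βn + s) ^ αn) (Ioo (-βn) βp) :=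
    ContinuousOn.rpow_const (by fun_prop) fun x hx => Or.inl (by have := hx.1; linarith)
  unfold bctsExponent
  fun_prop

end BCTS

/-! ### Uniform grids on [0, t] -/

/-- The `k`-th point of the partition of `[0, t]` into `n + 1` intervals of equal length. -/
noncomputable def gridPoint (t : ℝ≥0) (n k : ℕ) : ℝ≥0 := t * k / (n + 1)

/-- The index of the first grid point to the right of `s`. -/
noncomputable def gridIndex (t : ℝ≥0) (n : ℕ) (s : ℝ≥0) : ℕ := ⌈s * (n + 1) / t⌉₊

section Grid

variable {t s : ℝ≥0} {n k : ℕ}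

lemma gridPoint_mono (t : ℝ≥0) (n : ℕ) : Monotone (gridPoint t n) := by
  intro j k h
  unfold gridPoint
  gcongr

lemma gridPoint_last : gridPoint t n (n + 1) = t := by
  rw [gridPoint]
  push_cast
  exact mul_div_cancel_right₀ t (by positivity)

lemma gridPoint_le (h : k ≤ n + 1) : gridPoint t n k ≤ t :=
  (gridPoint_mono t n h).trans_eq gridPoint_last

lemma gridPoint_succ : gridPoint t n (k + 1) = gridPoint t n k + t / (n + 1) := by
  rw [gridPoint, gridPoint]
  push_cast
  rw [mul_add, mul_one, add_div]

lemma gridIndex_mono (t : ℝ≥0) (n : ℕ) : Monotone (gridIndex t n) := by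
  intro a b h
  unfold gridIndex
  gcongr

lemma gridIndex_le (h : s ≤ t) : gridIndex t n s ≤ n + 1 := by
  rw [gridIndex, Nat.ceil_le]
  push_cast
  apply div_le_of_le_mul₀ (by positivity) (by positivity)
  rw [mul_comm]
  gcongr

lemma le_gridPoint_gridIndex (h : s ≤ t) : s ≤ gridPoint t n (gridIndex t n s) := by
  rcases eq_or_lt_of_le (zero_le (a := t)) with rfl | ht
  · simp [nonpos_iff_eq_zero.1 h]
  have := Nat.le_ceil (s * (n + 1) / t)
  rw [gridPoint, gridIndex, le_div_iff₀ (by positivity)]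
  rwa [div_le_iff₀ ht, mul_comm _ t] at this

lemma gridPoint_gridIndex_le (h : s ≤ t) :
    gridPoint t n (gridIndex t n s) ≤ s + t / (n + 1) := by
  rcases eq_or_lt_of_le (zero_le (a := t)) with rfl | ht
  · simp [gridPoint]
  have := Nat.ceil_lt_add_one (zero_le (a := s * (n + 1) / t))
  rw [gridPoint, gridIndex, div_le_iff₀ (by positivity)]
  calc t * ⌈s * (n + 1) / t⌉₊ ≤ t * (s * (n + 1) / t + 1) := by gcongr
    _ = _ := by field_simp

/-- The approach is from the right, so right-continuity of a path suffices along these points. -/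
lemma tendsto_gridPoint_gridIndex (h : s ≤ t) :
    Tendsto (fun n => gridPoint t n (gridIndex t n s)) atTop (𝓝[≥] s) := by
  refine tendsto_nhdsWithin_iff.2 ⟨?_, Eventually.of_forall fun n => le_gridPoint_gridIndex h⟩
  have h1 : Tendsto (fun n : ℕ => t / ((n : ℝ≥0) + 1)) atTop (𝓝 0) := by
    rw [← NNReal.tendsto_coe]
    push_cast
    exact tendsto_const_nhds.div_atTop
      (tendsto_atTop_add_const_right _ 1 tendsto_natCast_atTop_atTop)
  have h2 : Tendsto (fun n : ℕ => s + t / ((n : ℝ≥0) + 1)) atTop (𝓝 s) := by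
    simpa using h1.const_add s
  exact tendsto_of_tendsto_of_tendsto_of_le_of_le tendsto_const_nhds h2
    (fun n => le_gridPoint_gridIndex h) (fun n => gridPoint_gridIndex_le h)

lemma mem_Ioc_gridPoint_iff (ht : 0 < t) :
    s ∈ Ioc (gridPoint t n k) (gridPoint t n (k + 1)) ↔ gridIndex t n s = k + 1 := by
  have hn : (0 : ℝ≥0) < n + 1 := by positivity
  rw [gridIndex, Nat.ceil_eq_iff (by omega), mem_Ioc, gridPoint, gridPoint, div_lt_iff₀ hn,
    le_div_iff₀ hn, lt_div_iff₀ ht, div_le_iff₀ ht, Nat.add_sub_cancel, mul_comm t, mul_comm t]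

lemma sum_indicator_gridPoint (f : ℝ≥0 → ℝ) (hs : s ∈ Ioc 0 t) :
    ∑ k ∈ Finset.range (n + 1), (Ioc (gridPoint t n k) (gridPoint t n (k + 1))).indicator
      (fun _ => f (gridPoint t n (k + 1))) s = f (gridPoint t n (gridIndex t n s)) := by
  have ht : 0 < t := hs.1.trans_le hs.2
  have h1 : 0 < gridIndex t n s := by
    rw [gridIndex, Nat.ceil_pos]
    exact div_pos (mul_pos hs.1 (by positivity)) ht
  obtain ⟨j, hj⟩ : ∃ j, gridIndex t n s = j + 1 := ⟨_, (Nat.succ_pred_eq_of_pos h1).symm⟩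
  have h2 := gridIndex_le (n := n) hs.2
  rw [Finset.sum_eq_single j]
  · rw [indicator_of_mem ((mem_Ioc_gridPoint_iff ht).2 hj), hj]
  · intro k _ hk
    refine indicator_of_notMem (fun h => hk ?_) _
    have := (mem_Ioc_gridPoint_iff ht).1 h
    omega
  · intro h
    simp at h
    omega

end Grid

/-! ### Path variation and Riemann sums -/

section Paths

variable {g : ℝ≥0 → ℝ} (t : ℝ≥0)

/-- Variation is lower semicontinuous under pointwise convergence, and right-continuity makes the
stopped path a pointwise limit of step functions that take only its grid values. -/
lemma eVariationOn_stopped_le (hg : ∀ s, ContinuousWithinAt g (Ici s) s) :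
    eVariationOn (fun s => g (min s t)) univ ≤ liminf (fun n : ℕ =>
      ∑ k ∈ Finset.range (n + 1), ‖g (gridPoint t n (k + 1)) - g (gridPoint t n k)‖ₑ) atTop := by
  refine le_of_forall_lt fun v hv => ?_
  obtain ⟨w, hvw, hw⟩ := exists_between hv
  refine hvw.trans_le ?_
  refine le_liminf_of_le (by isBoundedDefault) ?_
  have hlim : ∀ s ∈ (univ : Set ℝ≥0), Tendsto
      (fun n => g (gridPoint t n (gridIndex t n (min s t)))) atTop (𝓝 (g (min s t))) :=
    fun s _ => (hg (min s t)).tendsto.comp (tendsto_gridPoint_gridIndex (min_le_right s t))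
  filter_upwards [eVariationOn.lowerSemicontinuous_aux hlim hw] with n hn
  refine hn.le.trans ?_
  simp_rw [← edist_eq_enorm_sub, edist_comm (g (gridPoint t n (_ + 1)))]
  rw [← eVariationOn.image_range_of_monotone g (gridPoint_mono t n)]
  refine eVariationOn.comp_le_of_monotoneOn g
    (fun s => gridPoint t n (gridIndex t n (min s t))) (fun a _ b _ hab => ?_) fun s _ => ?_
  · exact gridPoint_mono t n (gridIndex_mono t n (min_le_min_right t hab))
  · exact mem_image_of_mem _ (gridIndex_le (min_le_right s t))

/-- The Riemann sums of the Stieltjes integral. -/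
noncomputable def stieltjesSum (f g : ℝ≥0 → ℝ) (t : ℝ≥0) (n : ℕ) : ℝ :=
  ∑ k ∈ Finset.range (n + 1), f (gridPoint t n (k + 1)) *
    (g (gridPoint t n (k + 1)) - g (gridPoint t n k))

theorem tendsto_stieltjesSum {f : ℝ≥0 → ℝ} (hf : Continuous f)
    (hg : ∀ s, ContinuousWithinAt g (Ici s) s)
    (hbv : BoundedVariationOn (fun s => g (min s t)) univ) :
    Tendsto (stieltjesSum f g t) atTop (𝓝 (stieltjesIntegral f g t)) := by
  rw [stieltjesIntegral, dif_pos hbv]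
  -- The Stieltjes measure sees right limits only; for a right-continuous path these are the values
  -- of the path.
  have hright (s : ℝ≥0) : (fun s => g (min s t)).rightLim s = g (min s t) := by
    refine ContinuousWithinAt.rightLim_eq ?_
    refine ContinuousWithinAt.comp (f := fun s => min s t) (t := Ici (min s t)) (hg (min s t))
      (by fun_prop) fun u hu => min_le_min_right t hu
  -- Finite total variation makes the constant C an integrable majorant.
  have hfin : IsFiniteMeasure (hbv.vectorMeasure.restrict (Ioc 0 t)).variation := by
    rw [← SignedMeasure.totalVariation_eq_variation]; infer_instance
  have hsum (n : ℕ) : stieltjesSum f g t n =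
      ∫ᵛ s in Ioc 0 t, ∑ k ∈ Finset.range (n + 1),
        (Ioc (gridPoint t n k) (gridPoint t n (k + 1))).indicator
          (fun _ => f (gridPoint t n (k + 1))) s ∂•hbv.vectorMeasure := by
    rw [VectorMeasure.integral_finsetSum]
    · refine Finset.sum_congr rfl fun k hk => ?_
      rw [VectorMeasure.integral_indicator_const _ measurableSet_Ioc,
        VectorMeasure.restrict_apply _ measurableSet_Ioc measurableSet_Ioc, inter_eq_left.2,
        hbv.vectorMeasure_Ioc (gridPoint_mono t n k.le_succ), hright, hright, min_eq_left,
        min_eq_left]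
      · simp
      · exact gridPoint_le (Finset.mem_range.1 hk).le
      · exact gridPoint_le (Finset.mem_range.1 hk)
      · exact Ioc_subset_Ioc zero_le (gridPoint_le (Finset.mem_range.1 hk))
    · intro k _
      exact (integrable_const _).indicator measurableSet_Ioc
  rw [funext hsum]
  obtain ⟨C, hC⟩ := (isCompact_Icc (a := 0) (b := t)).exists_bound_of_continuousOn hf.continuousOn
  have hmem : ∀ᵐ s ∂(hbv.vectorMeasure.restrict (Ioc 0 t)).variation, s ∈ Ioc 0 t := by
    rw [VectorMeasure.variation_restrict measurableSet_Ioc]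
    exact ae_restrict_mem measurableSet_Ioc
  refine VectorMeasure.tendsto_integral_of_dominated_convergence (fun _ => C) (fun n => ?_)
    (integrable_const _) (fun n => ?_) ?_
  · exact (Finset.measurable_fun_sum _ fun k _ =>
      measurable_const.indicator measurableSet_Ioc).aestronglyMeasurable
  · filter_upwards [hmem] with s hs
    rw [sum_indicator_gridPoint f hs]
    exact hC _ ⟨zero_le, gridPoint_le (gridIndex_le hs.2)⟩
  · filter_upwards [hmem] with s hs
    simp_rw [sum_indicator_gridPoint f hs]
    exact (hf.tendsto s).comp
      ((tendsto_gridPoint_gridIndex hs.2).mono_right nhdsWithin_le_nhds)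

/-- Convergence of the Riemann sums of a continuous function. -/
theorem tendsto_riemannSum {f : ℝ≥0 → ℝ} (hf : ContinuousOn f (Iic t)) :
    Tendsto (fun n : ℕ => ∑ k ∈ Finset.range (n + 1),
      ((t / (n + 1) : ℝ≥0) : ℝ) * f (gridPoint t n (k + 1))) atTop
      (𝓝 (∫ v in (0 : ℝ)..t, f v.toNNReal)) := by
  let I (n k : ℕ) : Set ℝ := Ioc (gridPoint t n k : ℝ) (gridPoint t n (k + 1))
  have hI (n k : ℕ) : MeasurableSet (I n k) := measurableSet_Ioc
  have hsum (n : ℕ) : ∑ k ∈ Finset.range (n + 1),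
      ((t / (n + 1) : ℝ≥0) : ℝ) * f (gridPoint t n (k + 1)) =
      ∫ v in Ioc (0 : ℝ) t, ∑ k ∈ Finset.range (n + 1),
        (I n k).indicator (fun _ => f (gridPoint t n (k + 1))) v := by
    rw [integral_finsetSum _ fun k _ => (integrable_const _).indicator (hI n k)]
    refine Finset.sum_congr rfl fun k hk => ?_
    have hsub : I n k ⊆ Ioc (0 : ℝ) t := Ioc_subset_Ioc (NNReal.coe_nonneg _)
      (NNReal.coe_le_coe.2 (gridPoint_le (Finset.mem_range.1 hk)))
    rw [integral_indicator_const _ (hI n k), Measure.real, Measure.restrict_apply (hI n k),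
      inter_eq_left.2 hsub, Real.volume_Ioc, gridPoint_succ, NNReal.coe_add, add_sub_cancel_left,
      ENNReal.toReal_ofReal (NNReal.coe_nonneg _), smul_eq_mul]
  have hpt (n : ℕ) {v : ℝ} (hv : v ∈ Ioc (0 : ℝ) t) : ∑ k ∈ Finset.range (n + 1),
      (I n k).indicator (fun _ => f (gridPoint t n (k + 1))) v =
        f (gridPoint t n (gridIndex t n v.toNNReal)) ∧ v.toNNReal ∈ Ioc 0 t := by
    lift v to ℝ≥0 using hv.1.le
    have hv' : v ∈ Ioc 0 t := by simpa using hv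
    rw [Real.toNNReal_coe]
    refine ⟨?_, hv'⟩
    rw [← sum_indicator_gridPoint f hv']
    refine Finset.sum_congr rfl fun k _ => ?_
    simp [indicator_apply, I]
  rw [funext hsum, intervalIntegral.integral_of_le t.coe_nonneg]
  obtain ⟨C, hC⟩ := (isCompact_Icc (a := 0) (b := t)).exists_bound_of_continuousOn
    (hf.mono Icc_subset_Iic_self)
  refine tendsto_integral_of_dominated_convergence (fun _ => C) (fun n => ?_)
    (integrable_const _) (fun n => ?_) ?_
  · exact (Finset.measurable_fun_sum _ fun k _ =>
      measurable_const.indicator (hI n k)).aestronglyMeasurable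
  · filter_upwards [ae_restrict_mem measurableSet_Ioc] with v hv
    obtain ⟨h1, h2⟩ := hpt n hv
    rw [h1]
    exact hC _ ⟨zero_le, gridPoint_le (gridIndex_le h2.2)⟩
  · filter_upwards [ae_restrict_mem measurableSet_Ioc] with v hv
    have h2 := (hpt 0 hv).2.2
    refine Tendsto.congr (fun n => ((hpt n hv).1).symm) ?_
    exact (hf _ h2).tendsto.comp (tendsto_nhdsWithin_iff.2
      ⟨(tendsto_gridPoint_gridIndex h2).mono_right nhdsWithin_le_nhds,
        Eventually.of_forall fun n => gridPoint_le (gridIndex_le h2)⟩)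

end Paths

/-! ### Exponential moments of the process and of its integrals -/

lemma exists_one_lt_mul_mem_Ioo {r c d : ℝ} (hr : r ∈ Ioo c d) : ∃ p > 1, p * r ∈ Ioo c d := by
  have h : Tendsto (fun p : ℝ => p * r) (𝓝[>] 1) (𝓝 r) := by
    have := ((continuous_mul_const r).tendsto 1).mono_left (nhdsWithin_le_nhds (s := Ioi 1))
    rwa [one_mul] at this
  obtain ⟨p, hp, hp'⟩ := ((h.eventually (Ioo_mem_nhds hr.1 hr.2)).and self_mem_nhdsWithin).exists
  exact ⟨p, hp', hp⟩

lemma mgf_eq_toReal_lintegral {Ω : Type*} [MeasurableSpace Ω] {P : Measure Ω} {X : Ω → ℝ}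
    (hX : AEMeasurable X P) (r : ℝ) :
    mgf X P r = (∫⁻ x, ENNReal.ofReal (Real.exp (r * x)) ∂(P.map X)).toReal := by
  rw [← mgf_id_map hX, mgf, integral_eq_lintegral_of_nonneg_ae
    (ae_of_all _ fun x => Real.exp_nonneg _) (by fun_prop)]
  simp

section BCTSProcess

variable {Ω : Type*} [MeasurableSpace Ω] {P : Measure Ω} [IsProbabilityMeasure P]
  {αp αn βp βn cp cn : ℝ} {L : ℝ≥0 → Ω → ℝ}

lemma IsBCTSProcess.lintegral_enorm_le (hL : IsBCTSProcess L P αp αn βp βn cp cn)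
    (hαp : αp < 1) (hαn : αn < 1) (hβp : 0 < βp) (hβn : 0 < βn) (hcp : 0 ≤ cp) (hcn : 0 ≤ cn)
    (h : ℝ≥0) :
    ∫⁻ ω, ‖L h ω‖ₑ ∂P ≤ h * ∫⁻ x, ‖x‖ₑ ∂(bctsLevyMeasure αp αn βp βn cp cn) := by
  have := Measure.isProbabilityMeasure_map (hL.aemeasurable h)
  have h1 := lintegral_enorm_le_of_charFun
    (integrable_id_bctsLevyMeasure hαp hαn hβp hβn (by positivity) (by positivity))
    (P.map (L h)) (hL.law h)
  rwa [bctsLevyMeasure_mul, lintegral_smul_measure, lintegral_map' (by fun_prop)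
    (hL.aemeasurable h)] at h1

/-- The paths of a BCTS process with `αp, αn < 1` have bounded variation on compact intervals. -/
lemma IsBCTSProcess.ae_boundedVariationOn (hL : IsBCTSProcess L P αp αn βp βn cp cn)
    (hαp : αp < 1) (hαn : αn < 1) (hβp : 0 < βp) (hβn : 0 < βn) (hcp : 0 ≤ cp) (hcn : 0 ≤ cn)
    (t : ℝ≥0) :
    ∀ᵐ ω ∂P, BoundedVariationOn (fun s => L (min s t) ω) univ := by
  let V (n : ℕ) (ω : Ω) : ENNReal := ∑ k ∈ Finset.range (n + 1),
    ‖L (gridPoint t n (k + 1)) ω - L (gridPoint t n k) ω‖ₑ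
  set C := ∫⁻ x, ‖x‖ₑ ∂(bctsLevyMeasure αp αn βp βn cp cn)
  have hCtop : C < ⊤ :=
    (integrable_id_bctsLevyMeasure hαp hαn hβp hβn hcp hcn).hasFiniteIntegral
  have hVm (n : ℕ) : AEMeasurable (V n) P := Finset.aemeasurable_fun_sum _ fun k _ =>
    ((hL.aemeasurable _).sub (hL.aemeasurable _)).enorm
  have hV (n : ℕ) : ∫⁻ ω, V n ω ∂P ≤ t * C := by
    have hm (k : ℕ) :
        AEMeasurable (fun ω => ‖L (gridPoint t n (k + 1)) ω - L (gridPoint t n k) ω‖ₑ) P :=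
      ((hL.aemeasurable _).sub (hL.aemeasurable _)).enorm
    rw [lintegral_finsetSum' _ fun k _ => hm k]
    calc _ ≤ ∑ k ∈ Finset.range (n + 1), ((t / (n + 1) : ℝ≥0) : ENNReal) * C := by
          gcongr with k
          rw [gridPoint_succ]
          have := ((hL.stationary_increments (gridPoint t n k) (t / (n + 1))).comp
            (measurable_enorm (ε := ℝ))).lintegral_eq
          simp only [Function.comp_def] at this
          exact this.le.trans (hL.lintegral_enorm_le hαp hαn hβp hβn hcp hcn _)
      _ = _ := by
          rw [Finset.sum_const, Finset.card_range, nsmul_eq_mul, ← mul_assoc]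
          congr 1
          rw [← ENNReal.coe_natCast, ← ENNReal.coe_mul]
          congr 1
          push_cast
          exact mul_div_cancel₀ t (by positivity)
  -- Fatou: the expected grid variations are bounded by t C for every n.
  have hlim : ∫⁻ ω, liminf (fun n => V n ω) atTop ∂P ≤ t * C :=
    (lintegral_liminf_le' hVm).trans
      (liminf_le_of_frequently_le' (Frequently.of_forall hV))
  have hmeas : AEMeasurable (fun ω => liminf (fun n => V n ω) atTop) P := by
    refine ⟨_, Measurable.liminf fun n => (hVm n).measurable_mk, ?_⟩
    filter_upwards [ae_all_iff.2 fun n => (hVm n).ae_eq_mk] with ω hω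
    simp_rw [hω]
  have hfin : ∀ᵐ ω ∂P, liminf (fun n => V n ω) atTop < ⊤ :=
    ae_lt_top' hmeas
      (hlim.trans_lt (ENNReal.mul_lt_top ENNReal.coe_lt_top hCtop)).ne
  filter_upwards [hfin, hL.cadlag] with ω h1 h2
  exact ((eVariationOn_stopped_le t fun s => (h2 s).1).trans_lt h1).ne

/-- Time enters the law through cp h and cn h, which vanish at h = 0; hence only nonnegativity of
the intensities is assumed. -/
lemma IsBCTSProcess.mgf_eq (hL : IsBCTSProcess L P αp αn βp βn cp cn)
    (hαp : αp < 1) (hαp0 : αp ≠ 0) (hαn : αn < 1) (hαn0 : αn ≠ 0) (hβp : 0 < βp) (hβn : 0 < βn)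
    (hcp : 0 ≤ cp) (hcn : 0 ≤ cn) {r : ℝ} (hr : r ∈ Ioo (-βn) βp) (h : ℝ≥0) :
    mgf (L h) P r = Real.exp (h * bctsExponent αp αn βp βn cp cn r) := by
  have := Measure.isProbabilityMeasure_map (hL.aemeasurable h)
  obtain ⟨p, hp, hpr⟩ := exists_one_lt_mul_mem_Ioo hr
  have hch : 0 ≤ cp * h := by positivity
  have hcn' : 0 ≤ cn * h := by positivity
  obtain ⟨i1, e1⟩ := integral_exp_sub_one_bctsLevyMeasure hαp hαp0 hαn hαn0 hβp hβn hch hcn'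
    hr.1 hr.2
  have i2 := (integral_exp_sub_one_bctsLevyMeasure hαp hαp0 hαn hαn0 hβp hβn hch hcn'
    hpr.1 hpr.2).1
  have key := lintegral_exp_eq_of_charFun
    (integrable_id_bctsLevyMeasure hαp hαn hβp hβn hch hcn') (P.map (L h)) (hL.law h) hp i1 i2
  rw [← mgf_id_map (hL.aemeasurable h), mgf, integral_eq_lintegral_of_nonneg_ae
    (ae_of_all _ fun x => Real.exp_nonneg _) (by fun_prop)]
  simp only [id]
  rw [key, e1, ENNReal.toReal_ofReal (Real.exp_nonneg _), bctsExponent, bctsExponent]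
  ring_nf

lemma IsBCTSProcess.mgf_stieltjesSum (hL : IsBCTSProcess L P αp αn βp βn cp cn)
    (hαp : αp < 1) (hαp0 : αp ≠ 0) (hαn : αn < 1) (hαn0 : αn ≠ 0) (hβp : 0 < βp) (hβn : 0 < βn)
    (hcp : 0 ≤ cp) (hcn : 0 ≤ cn) (f : ℝ≥0 → ℝ) (t : ℝ≥0) (n : ℕ) {r : ℝ}
    (hr : ∀ v ≤ t, r * f v ∈ Ioo (-βn) βp) :
    mgf (fun ω => stieltjesSum f (fun s => L s ω) t n) P r =
      Real.exp (∑ k ∈ Finset.range (n + 1), ((t / (n + 1) : ℝ≥0) : ℝ) *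
        bctsExponent αp αn βp βn cp cn (r * f (gridPoint t n (k + 1)))) := by
  have hind := (hL.indep_increments.nat (gridPoint_mono t n)).comp
    (fun k x => f (gridPoint t n (k + 1)) * x) fun k => by fun_prop
  have hmeas (k : ℕ) : AEMeasurable ((fun x => f (gridPoint t n (k + 1)) * x) ∘ fun ω =>
      L (gridPoint t n (k + 1)) ω - L (gridPoint t n k) ω) P :=
    ((hL.aemeasurable _).sub (hL.aemeasurable _)).const_mul _
  have hfun : (fun ω => stieltjesSum f (fun s => L s ω) t n) =
      ∑ k ∈ Finset.range (n + 1), (fun x => f (gridPoint t n (k + 1)) * x) ∘ fun ω =>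
        L (gridPoint t n (k + 1)) ω - L (gridPoint t n k) ω := by
    ext ω
    simp [stieltjesSum, Finset.sum_apply]
  rw [hfun, hind.mgf_sum₀ hmeas, Real.exp_sum]
  refine Finset.prod_congr rfl fun k hk => ?_
  have hstat := hL.stationary_increments (gridPoint t n k) (t / (n + 1))
  rw [← gridPoint_succ] at hstat
  rw [← hL.mgf_eq hαp hαp0 hαn hαn0 hβp hβn hcp hcn
    (hr _ (gridPoint_le (Finset.mem_range.1 hk))), ← mgf_congr_of_identDistrib _ _ hstat]
  simp only [mgf, Function.comp_apply, mul_assoc]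

/-- The exponential moments of the Stieltjes integral of a continuous function with respect to a
BCTS process. -/
theorem IsBCTSProcess.mgf_stieltjesIntegral (hL : IsBCTSProcess L P αp αn βp βn cp cn)
    (hαp : αp < 1) (hαp0 : αp ≠ 0) (hαn : αn < 1) (hαn0 : αn ≠ 0) (hβp : 0 < βp) (hβn : 0 < βn)
    (hcp : 0 ≤ cp) (hcn : 0 ≤ cn) {f : ℝ≥0 → ℝ} (hf : Continuous f) (t : ℝ≥0) {p r : ℝ}
    (hp : 1 < p) (hr : ∀ v ≤ t, r * f v ∈ Ioo (-βn) βp)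
    (hpr : ∀ v ≤ t, p * r * f v ∈ Ioo (-βn) βp) :
    mgf (fun ω => stieltjesIntegral f (fun s => L s ω) t) P r =
      Real.exp (∫ v in (0 : ℝ)..t, bctsExponent αp αn βp βn cp cn (r * f v.toNNReal)) := by
  set Z := fun ω => stieltjesIntegral f (fun s => L s ω) t
  set S : ℕ → Ω → ℝ := fun n ω => stieltjesSum f (fun s => L s ω) t n
  have hlim : ∀ᵐ ω ∂P, Tendsto (fun n => S n ω) atTop (𝓝 (Z ω)) := by
    filter_upwards [hL.ae_boundedVariationOn hαp hαn hβp hβn hcp hcn t, hL.cadlag] with ω h1 h2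
    exact tendsto_stieltjesSum t hf (fun s => (h2 s).1) h1
  have hSm (n : ℕ) : AEMeasurable (S n) P := Finset.aemeasurable_fun_sum _ fun k _ =>
    ((hL.aemeasurable _).sub (hL.aemeasurable _)).const_mul _
  have hZm : AEMeasurable Z P := aemeasurable_of_tendsto_metrizable_ae atTop hSm hlim
  have hdist := tendstoInDistribution_of_ae_tendsto hSm hZm hlim
  have hriem {q : ℝ} (hq : ∀ v ≤ t, q * f v ∈ Ioo (-βn) βp) :
      Tendsto (fun n => ∫⁻ x, ENNReal.ofReal (Real.exp (q * x)) ∂(P.map (S n))) atTop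
        (𝓝 (ENNReal.ofReal (Real.exp (∫ v in (0 : ℝ)..t,
          bctsExponent αp αn βp βn cp cn (q * f v.toNNReal))))) := by
    have h1 := tendsto_riemannSum t (f := fun v => bctsExponent αp αn βp βn cp cn (q * f v))
      (continuousOn_bctsExponent.comp (by fun_prop) hq)
    have h2 (n : ℕ) := hL.mgf_stieltjesSum hαp hαp0 hαn hαn0 hβp hβn hcp hcn f t n hq
    refine (ENNReal.tendsto_ofReal ((Real.continuous_exp.tendsto _).comp h1)).congr fun n => ?_
    have h3 := h2 n
    rw [mgf_eq_toReal_lintegral (hSm n)] at h3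
    rw [Function.comp_apply, ← h3, ENNReal.ofReal_toReal]
    -- An infinite integral would have `toReal` equal to 0, whereas an exponential is positive.
    intro htop
    rw [htop] at h3
    exact (Real.exp_pos _).ne h3
  -- The moments of order p r converge, so eventually they stay below their limit plus 1.
  have key := lintegral_exp_eq_of_tendsto hdist.tendsto hp
    (ENNReal.add_ne_top.2 ⟨ENNReal.ofReal_ne_top, ENNReal.one_ne_top⟩)
    ((hriem hpr).eventually_le_const (ENNReal.lt_add_right ENNReal.ofReal_ne_top one_ne_zero))
    (hriem hr)
  rw [mgf_eq_toReal_lintegral hZm]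
  exact (congrArg ENNReal.toReal key).trans (ENNReal.toReal_ofReal (Real.exp_nonneg _))

end BCTSProcess

/-! ### The time integral in closed form -/

/-- With z = β exp(bv) one has β - s exp(-bv) = β (z - s)/z and dz = b z dv, which gives `tildeI`.
The constant -β^α integrates to -β^α t, and -t is log(exp(-bt)) / b. -/
lemma integral_sub_exp_rpow {α β s b t : ℝ} (hβ : 0 < β) (hs : s < β) (hb : 0 < b) (ht : 0 ≤ t) :
    ∫ v in (0 : ℝ)..t, ((β - s * Real.exp (-(b * v))) ^ α - β ^ α) =
      β ^ α / b * (tildeI s α β (β / Real.exp (-(b * t))) + Real.log (Real.exp (-(b * t)))) := by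
  have hge {v : ℝ} (hv : 0 ≤ v) : β ≤ β * Real.exp (b * v) :=
    le_mul_of_one_le_right hβ.le (Real.one_le_exp (by positivity))
  have hpos {v : ℝ} (hv : 0 ≤ v) : 0 < β - s * Real.exp (-(b * v)) := by
    have h1 := hge hv
    have h2 : β - s * Real.exp (-(b * v)) =
        (β * Real.exp (b * v) - s) * Real.exp (-(b * v)) := by
      rw [sub_mul, mul_assoc, ← Real.exp_add]; simp
    rw [h2]
    exact mul_pos (by linarith) (Real.exp_pos _)
  have hsub : tildeI s α β (β / Real.exp (-(b * t))) =
      ∫ v in (0 : ℝ)..t, b / β ^ α * (β - s * Real.exp (-(b * v))) ^ α := by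
    have hend : β / Real.exp (-(b * t)) = β * Real.exp (b * t) := by
      rw [Real.exp_neg, div_inv_eq_mul]
    have hcv := intervalIntegral.integral_comp_mul_deriv' (a := 0) (b := t)
      (f := fun v => β * Real.exp (b * v)) (f' := fun v => β * (Real.exp (b * v) * (b * 1)))
      (g := fun z => z ^ (-1 - α) * (z - s) ^ α)
      (fun v _ => (((hasDerivAt_id v).const_mul b).exp).const_mul β) (by fun_prop) (by
        rw [uIcc_of_le ht]
        rintro z ⟨v, hv, rfl⟩
        have := hge hv.1
        refine ContinuousAt.continuousWithinAt ?_
        refine (Real.continuousAt_rpow_const _ _ (Or.inl ?_)).mul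
          ((continuousAt_id.sub continuousAt_const).rpow_const (Or.inl ?_))
        · simp only; linarith
        · simp only [Pi.sub_apply, id]; linarith)
    rw [tildeI, hend]
    simp only [mul_zero, Real.exp_zero, mul_one] at hcv
    rw [← hcv]
    refine intervalIntegral.integral_congr fun v hv => ?_
    rw [uIcc_of_le ht] at hv
    have h1 := hge hv.1
    have hz : 0 < β * Real.exp (b * v) := by positivity
    have h2 : β - s * Real.exp (-(b * v)) = β * ((β * Real.exp (b * v) - s) /
        (β * Real.exp (b * v))) := by
      rw [Real.exp_neg]; field_simp
    simp only [Function.comp_apply]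
    rw [h2, Real.mul_rpow hβ.le (div_nonneg (by linarith) hz.le),
      Real.div_rpow (by linarith) hz.le, show -1 - α = -α - 1 by ring, Real.rpow_sub_one hz.ne',
      Real.rpow_neg hz.le]
    field_simp
  have hcont : ContinuousOn (fun v : ℝ => (β - s * Real.exp (-(b * v))) ^ α) (uIcc 0 t) := by
    rw [uIcc_of_le ht]
    exact ContinuousOn.rpow_const (by fun_prop) fun v hv => Or.inl (hpos hv.1).ne'
  rw [hsub, intervalIntegral.integral_const_mul, intervalIntegral.integral_sub
    hcont.intervalIntegrable (by simp), Real.log_exp, intervalIntegral.integral_const]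
  have : β ^ α ≠ 0 := (Real.rpow_pos_of_pos hβ α).ne'
  simp only [smul_eq_mul]
  field_simp
  ring

theorem mainTheorem5 {Ω : Type*} [MeasurableSpace Ω] (P : Measure Ω) [IsProbabilityMeasure P]
    (αp αn βp βn cp cn b : ℝ)
    (hαp : αp < 1) (hαp0 : αp ≠ 0) (hαn : αn < 1) (hαn0 : αn ≠ 0)
    (hβp : 0 < βp) (hβn : 0 < βn) (hcp : 0 < cp) (hcn : 0 < cn) (hb : 0 < b)
    (L : ℝ≥0 → Ω → ℝ) (hL : IsBCTSProcess L P αp αn βp βn cp cn)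
    (t : ℝ≥0) (a : ℝ) (ha : a = Real.exp (-(b * t)))
    (s : ℝ) (hs : -βn < s) (hs' : s < βp) :
    Integrable (fun ω => Real.exp (s * ouIntegral b L t ω)) P ∧
    cgf (ouIntegral b L t) P s =
      -(cp * βp ^ αp * Real.Gamma (1 - αp) / (αp * b)) *
          (tildeI s αp βp (βp / a) + Real.log a)
      - cn * βn ^ αn * Real.Gamma (1 - αn) / (αn * b) *
          (tildeI (-s) αn βn (βn / a) + Real.log a) := by
  obtain ⟨p, hp, hps⟩ := exists_one_lt_mul_mem_Ioo ⟨hs, hs'⟩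
  have hmem {r v : ℝ} (hr : r ∈ Ioo (-βn) βp) (hv : 0 ≤ v) :
      r * Real.exp (-(b * v)) ∈ Ioo (-βn) βp := by
    have h1 : Real.exp (-(b * v)) ≤ 1 := by
      rw [Real.exp_le_one_iff, neg_nonpos]; positivity
    have h2 := Real.exp_pos (-(b * v))
    rw [mul_comm]
    -- The interval is convex and contains 0, so a factor in [0, 1] keeps a point inside.
    exact (convex_Ioo (-βn) βp).smul_mem_of_zero_mem ⟨neg_lt_zero.2 hβn, hβp⟩ hr ⟨h2.le, h1⟩
  have hmem' {r : ℝ} (hr : r ∈ Ioo (-βn) βp) (v : ℝ≥0) (hv : v ≤ t) :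
      r * Real.exp (-(b * ((t : ℝ) - v))) ∈ Ioo (-βn) βp :=
    hmem hr (sub_nonneg.2 (NNReal.coe_le_coe.2 hv))
  have hmgf : mgf (ouIntegral b L t) P s = _ :=
    hL.mgf_stieltjesIntegral hαp hαp0 hαn hαn0 hβp hβn hcp.le hcn.le
      (f := fun v => Real.exp (-(b * ((t : ℝ) - v)))) (by fun_prop) t hp (hmem' ⟨hs, hs'⟩)
      (hmem' hps)
  refine ⟨?_, ?_⟩
  -- Without integrability `mgf` would take its default value 0, but it equals an exponential.
  · by_contra h
    rw [mgf_undef h] at hmgf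
    exact (Real.exp_pos _).ne hmgf
  -- Time reversal v ↦ t - v.
  have hrev : ∫ v in (0 : ℝ)..t, bctsExponent αp αn βp βn cp cn
        (s * Real.exp (-(b * ((t : ℝ) - (v.toNNReal : ℝ))))) =
      ∫ v in (0 : ℝ)..t, bctsExponent αp αn βp βn cp cn (s * Real.exp (-(b * v))) := by
    have h := intervalIntegral.integral_comp_sub_left (a := 0) (b := t)
      (fun v => bctsExponent αp αn βp βn cp cn (s * Real.exp (-(b * v)))) (t : ℝ)
    rw [sub_self, sub_zero] at h
    rw [← h]
    refine intervalIntegral.integral_congr fun v hv => ?_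
    rw [uIcc_of_le t.coe_nonneg] at hv
    simp only [Real.coe_toNNReal v hv.1]
  have hint {α β c r : ℝ} (hα : ∀ v ∈ Icc (0 : ℝ) t, 0 < β - r * Real.exp (-(b * v))) :
      IntervalIntegrable (fun v => c * ((β - r * Real.exp (-(b * v))) ^ α - β ^ α)) volume 0 t := by
    refine ContinuousOn.intervalIntegrable ?_
    rw [uIcc_of_le t.coe_nonneg]
    exact (((ContinuousOn.rpow_const (by fun_prop) fun v hv => Or.inl (hα v hv).ne').sub
      continuousOn_const)).const_mul c
  have hexp (v : ℝ) : bctsExponent αp αn βp βn cp cn (s * Real.exp (-(b * v))) =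
      -(cp * (Real.Gamma (1 - αp) / αp)) * ((βp - s * Real.exp (-(b * v))) ^ αp - βp ^ αp) -
        cn * (Real.Gamma (1 - αn) / αn) * ((βn - -s * Real.exp (-(b * v))) ^ αn - βn ^ αn) := by
    rw [bctsExponent, neg_mul s, sub_neg_eq_add, neg_mul]
  rw [cgf, hmgf, Real.log_exp, hrev]
  simp_rw [hexp]
  rw [intervalIntegral.integral_sub (hint fun v hv => by
      have := (hmem ⟨hs, hs'⟩ hv.1).2; linarith) (hint fun v hv => by
      have := (hmem ⟨hs, hs'⟩ hv.1).1; linarith),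
    intervalIntegral.integral_const_mul, intervalIntegral.integral_const_mul,
    integral_sub_exp_rpow hβp hs' hb t.coe_nonneg,
    integral_sub_exp_rpow hβn (by linarith) hb t.coe_nonneg, ← ha]
  field_simp
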